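/- For $(\tau,\sigma)\in\mathbb R^2$ and $f\in L^2(\mathbb R)$ let $\rho(\tau,\sigma)f(t)=e^{\pi i\tau\sigma}e^{2\pi i\sigma t}f(t+\tau)$. Fix a window $\phi\in L^2(\mathbb R)$ with $\|\phi\|=1$ and let $$\mathcal S_\phi f(\tau,\sigma)=\langle f,\rho(\tau,\sigma)\phi\rangle=\int_{\mathbb R} f(t)\,\overline{\rho(\tau,\sigma)\phi(t)}\,dt .$$ For a bounded measurable set $\Omega\subset\mathbb R^2$ let $\mathcal C_\Omega:L^2(\mathbb R)\to L^2(\mathbb R)$ be the concentration operator, that is, the unique bounded operator with $$\langle \mathcal C_\Omega f,g\rangle=\iint_\Omega \langle f,\rho(\tau,\sigma)\phi\rangle\,\langle\rho(\tau,\sigma)\phi,g\rangle\,d\tau\,d\sigma\qquad\text{for all } f,g\in L^2(\mathbb R),$$ and for $r>0$ let $\Omega_r=\{(r\tau,r\sigma):(\tau,\sigma)\in\Omega\}$. **Theorem.** Let $\Omega\subset\mathbb R^2$ be a bounded domain (nonempty connected open set) with $C^1$ boundary, and let $0<\lambda<\mu<1$. Assume that there are constants $p,A>0$ such that $$\Bigl|1-\iint_{B_r}|\mathcal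 S_\phi\phi(\tau,\sigma)|^2\,d\tau\,d\sigma\Bigr|\le \frac{A}{r^p}\qquad\text{for all } r>0,$$ where $B_r$ is the Euclidean disc of radius $r$ centred at the origin. Then there is a constant $C>0$ (depending only on $\phi,\Omega,\lambda,\mu$) such that for every $r>0$ the number $n(\lambda,\mu,\Omega_r)$ of eigenvalues of $\mathcal C_{\Omega_r}$ lying in $[\lambda,\mu]$, counted with multiplicity, satisfies $$n(\lambda,\mu,\Omega_r)\le C\,r .$$ -/

import Mathlib

open MeasureTheory Set

noncomputable section

namespace Gabor

/-- The Hilbert space of square integrable complex functions on the real line. -/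
abbrev L2 : Type := Lp ℂ 2 (volume : Measure ℝ)

/-- The time-frequency shift `exp(π i τ σ) exp(2 π i σ t) f(t + τ)`, with `z = (τ, σ)`,
of a function. -/
def shiftFun (z : ℝ × ℝ) (f : ℝ → ℂ) (t : ℝ) : ℂ :=
  Complex.exp (Real.pi * Complex.I * z.1 * z.2) *
    Complex.exp (2 * Real.pi * Complex.I * z.2 * t) * f (t + z.1)

theorem norm_phase (z : ℝ × ℝ) (t : ℝ) :
    ‖Complex.exp (Real.pi * Complex.I * z.1 * z.2) *
      Complex.exp (2 * Real.pi * Complex.I * z.2 * t)‖ = 1 := by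
  have h1 : (Real.pi * Complex.I * z.1 * z.2 : ℂ) = ((Real.pi * z.1 * z.2 : ℝ) : ℂ) * Complex.I := by
    push_cast; ring
  have h2 : (2 * Real.pi * Complex.I * z.2 * t : ℂ)
      = ((2 * Real.pi * z.2 * t : ℝ) : ℂ) * Complex.I := by
    push_cast; ring
  rw [h1, h2, norm_mul, Complex.norm_exp_ofReal_mul_I, Complex.norm_exp_ofReal_mul_I, one_mul]

theorem memLp_shiftFun (z : ℝ × ℝ) (f : L2) : MemLp (shiftFun z f) 2 volume := by
  have h : MemLp (fun t => f (t + z.1)) 2 volume :=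
    (Lp.memLp f).comp_measurePreserving (measurePreserving_add_right volume z.1)
  refine h.of_le ?_ (Filter.Eventually.of_forall fun t => ?_)
  · refine AEStronglyMeasurable.mul ?_ h.1
    exact Continuous.aestronglyMeasurable (by fun_prop)
  · rw [shiftFun, norm_mul, norm_phase, one_mul]

/-- The time-frequency shift `ρ(τ, σ)` on `L²(ℝ)`, with `z = (τ, σ)`. -/
def shift (z : ℝ × ℝ) (f : L2) : L2 := (memLp_shiftFun z f).toLp (shiftFun z f)

/-- The Gabor transform `S_φ f (z) = ⟨f, ρ(z) φ⟩ = ∫ f(t) conj(ρ(z) φ(t)) dt`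
(Mathlib's inner product is linear in the second argument). -/
def gabor (φ f : L2) (z : ℝ × ℝ) : ℂ := inner ℂ (shift z φ) f

/-- The form `E_Ω(f, g) = ∫∫_Ω ⟨f, ρ(z) φ⟩ ⟨ρ(z) φ, g⟩ dz`. -/
def energyForm (φ : L2) (Ω : Set (ℝ × ℝ)) (f g : L2) : ℂ :=
  ∫ z in Ω, gabor φ f z * inner ℂ g (shift z φ)

open Classical in
/-- The concentration operator `C_Ω`: the bounded operator on `L²(ℝ)` with
`⟨C_Ω f, g⟩ = E_Ω(f, g)` for all `f, g`. It is unique; see `inner_concentrationOp` for its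
existence when `Ω` has finite measure. -/
def concentrationOp (φ : L2) (Ω : Set (ℝ × ℝ)) : L2 →L[ℂ] L2 :=
  if h : ∃ T : L2 →L[ℂ] L2, ∀ f g, inner ℂ g (T f) = energyForm φ Ω f g then h.choose else 0

theorem gabor_eq_integral (φ f : L2) (z : ℝ × ℝ) :
    gabor φ f z = ∫ t, f t * (starRingEnd ℂ) (shiftFun z φ t) := by
  rw [gabor, L2.inner_def]
  refine integral_congr_ae ?_
  filter_upwards [(memLp_shiftFun z φ).coeFn_toLp] with t ht
  rw [shift, ht]
  simp

theorem norm_shift (z : ℝ × ℝ) (f : L2) : ‖shift z f‖ = ‖f‖ := by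
  rw [shift, Lp.norm_toLp, Lp.norm_def]
  congr 1
  have h1 : eLpNorm (shiftFun z f) 2 volume = eLpNorm (fun t => f (t + z.1)) 2 volume := by
    refine eLpNorm_congr_norm_ae (Filter.Eventually.of_forall fun t => ?_)
    rw [shiftFun, norm_mul, norm_phase, one_mul]
  rw [h1]
  exact eLpNorm_comp_measurePreserving (Lp.aestronglyMeasurable f)
    (measurePreserving_add_right volume z.1)

theorem norm_gabor_le (φ f : L2) (z : ℝ × ℝ) : ‖gabor φ f z‖ ≤ ‖φ‖ * ‖f‖ := by
  have := norm_inner_le_norm (𝕜 := ℂ) (shift z φ) f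
  rwa [norm_shift] at this

theorem stronglyMeasurable_gabor (φ f : L2) : StronglyMeasurable (gabor φ f) := by
  have h : gabor φ f = fun z => ∫ t, f t * (starRingEnd ℂ) (shiftFun z φ t) :=
    funext (gabor_eq_integral φ f)
  rw [h]
  have hf : Measurable (f : ℝ → ℂ) := (Lp.stronglyMeasurable f).measurable
  have hφ : Measurable (φ : ℝ → ℂ) := (Lp.stronglyMeasurable φ).measurable
  have hm : Measurable (fun p : (ℝ × ℝ) × ℝ => f p.2 * (starRingEnd ℂ) (shiftFun p.1 φ p.2)) := by
    refine (hf.comp measurable_snd).mul (Complex.continuous_conj.measurable.comp ?_)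
    unfold shiftFun
    refine Measurable.mul ?_ (hφ.comp (by fun_prop))
    exact Continuous.measurable (by fun_prop)
  exact hm.stronglyMeasurable.integral_prod_right (ν := (volume : Measure ℝ))

theorem inner_shift_eq (φ g : L2) (z : ℝ × ℝ) :
    inner ℂ g (shift z φ) = (starRingEnd ℂ) (gabor φ g z) := by
  rw [gabor, inner_conj_symm]

theorem integrableOn_energy (φ : L2) (Ω : Set (ℝ × ℝ)) (hΩ : volume Ω ≠ ⊤) (f g : L2) :
    IntegrableOn (fun z => gabor φ f z * inner ℂ g (shift z φ)) Ω := by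
  refine IntegrableOn.of_bound hΩ.lt_top ?_ ((‖φ‖ * ‖f‖) * (‖φ‖ * ‖g‖))
    (Filter.Eventually.of_forall fun z => ?_)
  · simp only [inner_shift_eq]
    exact ((stronglyMeasurable_gabor φ f).mul
      (Complex.continuous_conj.comp_stronglyMeasurable
        (stronglyMeasurable_gabor φ g))).aestronglyMeasurable
  · rw [norm_mul, inner_shift_eq, RCLike.norm_conj]
    exact mul_le_mul (norm_gabor_le φ f z) (norm_gabor_le φ g z) (norm_nonneg _) (by positivity)

theorem exists_concentrationOp (φ : L2) (Ω : Set (ℝ × ℝ)) (hΩ : volume Ω ≠ ⊤) :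
    ∃ T : L2 →L[ℂ] L2, ∀ f g, inner ℂ g (T f) = energyForm φ Ω f g := by
  have hi := integrableOn_energy φ Ω hΩ
  let B : L2 →ₗ⋆[ℂ] L2 →ₗ[ℂ] ℂ := LinearMap.mk₂'ₛₗ (starRingEnd ℂ) (RingHom.id ℂ)
    (fun g f => energyForm φ Ω f g)
    (fun g g' f => by
      simp only [energyForm, inner_add_left, mul_add]
      exact integral_add (hi f g) (hi f g'))
    (fun c g f => by
      simp only [energyForm, inner_smul_left, smul_eq_mul]
      rw [← integral_const_mul]
      congr 1; ext z; ring)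
    (fun g f f' => by
      simp only [energyForm, gabor, inner_add_right, add_mul]
      exact integral_add (hi f g) (hi f' g))
    (fun c g f => by
      simp only [energyForm, gabor, inner_smul_right, smul_eq_mul, RingHom.id_apply]
      rw [← integral_const_mul]
      congr 1; ext z; ring)
  let A : L2 →L⋆[ℂ] L2 →L[ℂ] ℂ := B.mkContinuous₂ (‖φ‖ ^ 2 * volume.real Ω) (fun g f => by
    have h := norm_setIntegral_le_of_norm_le_const (μ := (volume : Measure (ℝ × ℝ)))
      (f := fun z => gabor φ f z * inner ℂ g (shift z φ)) (C := (‖φ‖ * ‖f‖) * (‖φ‖ * ‖g‖))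
      hΩ.lt_top (fun z _ => by
        rw [norm_mul, inner_shift_eq, RCLike.norm_conj]
        exact mul_le_mul (norm_gabor_le φ f z) (norm_gabor_le φ g z) (norm_nonneg _)
          (by positivity))
    calc ‖B g f‖ ≤ (‖φ‖ * ‖f‖) * (‖φ‖ * ‖g‖) * volume.real Ω := h
      _ = _ := by ring)
  refine ⟨ContinuousLinearMap.adjoint (InnerProductSpace.continuousLinearMapOfBilin A),
    fun f g => ?_⟩
  rw [ContinuousLinearMap.adjoint_inner_right,
    InnerProductSpace.continuousLinearMapOfBilin_apply]
  rfl

theorem inner_concentrationOp (φ : L2) (Ω : Set (ℝ × ℝ)) (hΩ : volume Ω ≠ ⊤) (f g : L2) :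
    inner ℂ g (concentrationOp φ Ω f) = energyForm φ Ω f g := by
  rw [concentrationOp, dif_pos (exists_concentrationOp φ Ω hΩ)]
  exact (exists_concentrationOp φ Ω hΩ).choose_spec f g

/-- The number of eigenvalues of `T` in `[a, b]`, counted with multiplicity: the sum over
`ν ∈ [a, b]` of the dimension of `ker (T - ν)`, as an element of `[0, ∞]`. -/
def eigenvalueCount (T : L2 →L[ℂ] L2) (a b : ℝ) : ENNReal :=
  ∑' ν : Icc a b,
    ((Cardinal.toENat
      (Module.rank ℂ (Module.End.eigenspace (T : L2 →ₗ[ℂ] L2) ((ν : ℝ) : ℂ))) : ℕ∞) : ENNReal)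

/-- The dilated region `Ω_r = {(r τ, r σ) : (τ, σ) ∈ Ω}`. -/
def dilate (r : ℝ) (Ω : Set (ℝ × ℝ)) : Set (ℝ × ℝ) := (fun z => (r * z.1, r * z.2)) '' Ω

/-- The Euclidean disc of radius `r` about the origin of the time-frequency plane. -/
def disc (r : ℝ) : Set (ℝ × ℝ) := {z | z.1 ^ 2 + z.2 ^ 2 < r ^ 2}

/-- A bounded plane domain with `C¹` boundary: a nonempty bounded connected open set which, near
each of its boundary points, is the set where a `C¹` function with nonvanishing differential is
negative. -/
structure IsBoundedC1Domain (Ω : Set (ℝ × ℝ)) : Prop where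
  isOpen : IsOpen Ω
  isConnected : IsConnected Ω
  isBounded : Bornology.IsBounded Ω
  boundary : ∀ x ∈ frontier Ω, ∃ U : Set (ℝ × ℝ), ∃ g : ℝ × ℝ → ℝ,
    IsOpen U ∧ x ∈ U ∧ ContDiffOn ℝ 1 g U ∧ (∀ y ∈ U, fderiv ℝ g y ≠ 0) ∧
      Ω ∩ U = {y ∈ U | g y < 0}

/-- The decay condition `|1 - ∫_{B_r} f| ≤ C / r ^ p` for all `r > 0`, with some constants
`p, C > 0`. -/
def TailDecay (f : ℝ × ℝ → ℝ) : Prop :=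
  ∃ p C : ℝ, 0 < p ∧ 0 < C ∧ ∀ r : ℝ, 0 < r → |1 - ∫ z in disc r, f z| ≤ C / r ^ p

end Gabor

end

/-!
Write `A_D f` for the restriction of `gabor φ f` to `D`. Then `C_D = A_D* A_D`, and for a unit
window `C_D + C_{Dᶜ} = 1`, so an eigenvector `C_D f = ν f` with `ν < 1` satisfies
`f = (1 - ν)⁻¹ A_{Dᶜ}* A_{Dᶜ} f`. Its energy on `E` is therefore controlled by the norm of the
block `A_E A_{Dᶜ}*`, which tends to zero as the distance from `E` to `Dᶜ` grows: for windows with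
integrable `gabor φ φ` this is Young's inequality, and such windows are dense. Hence a unit
eigenvector with eigenvalue in `[λ, μ]` keeps energy at least `λ / 2` in the part of `D` within a
fixed distance of `Dᶜ`. By Bessel's inequality `n` orthonormal eigenvectors have together at most
the area of this collar as energy there, and for `D = Ω_r` that area is `O(r)`.
-/

noncomputable section

namespace Gabor

open Filter Topology
open scoped ContDiff FourierTransform ENNReal NNReal Pointwise InnerProduct

section Plancherel

theorem eLpNorm_two_sq {α F : Type*} [MeasurableSpace α] [NormedAddCommGroup F] (μ : Measure α)
    (f : α → F) : eLpNorm f 2 μ ^ 2 = ∫⁻ x, ‖f x‖ₑ ^ 2 ∂μ := by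
  have h := eLpNorm_nnreal_pow_eq_lintegral (f := f) (μ := μ) (p := 2) two_ne_zero
  simpa only [NNReal.coe_ofNat, ENNReal.coe_ofNat, ENNReal.rpow_ofNat] using h

theorem enorm_Lp_two_sq {α F : Type*} [MeasurableSpace α] [NormedAddCommGroup F] {μ : Measure α}
    (f : Lp F 2 μ) : ‖f‖ₑ ^ 2 = ∫⁻ x, ‖f x‖ₑ ^ 2 ∂μ := by
  rw [Lp.enorm_def, eLpNorm_two_sq]

variable {E F : Type*} [NormedAddCommGroup E] [InnerProductSpace ℝ E] [FiniteDimensional ℝ E]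
  [MeasurableSpace E] [BorelSpace E]
  [NormedAddCommGroup F] [InnerProductSpace ℂ F] [CompleteSpace F]

theorem coeFn_fourier_ae_eq (f : Lp F 2 (volume : Measure E)) (hf : Integrable f) :
    (𝓕 f : Lp F 2 (volume : Measure E)) =ᵐ[volume] 𝓕 (f : E → F) := by
  have hcont : Continuous (𝓕 (f : E → F)) :=
    VectorFourier.fourierIntegral_continuous Real.continuous_fourierChar continuous_inner hf
  refine ae_eq_of_integral_contDiff_smul_eq
    ((Lp.memLp _).locallyIntegrable one_le_two) hcont.locallyIntegrable fun g hg hgc => ?_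
  let G : SchwartzMap E ℂ := HasCompactSupport.toSchwartzMap
    (f := fun x => (g x : ℂ)) (hgc.comp_left Complex.ofReal_zero)
      (Complex.ofRealCLM.contDiff.comp hg)
  have hdual : ∫ x, 𝓕 G x • f x = ∫ x, G x • (𝓕 f : Lp F 2 (volume : Measure E)) x := by
    simpa only [TemperedDistribution.fourier_apply, Lp.toTemperedDistribution_apply]
      using congrArg (· G) (Lp.fourier_toTemperedDistribution_eq f)
  have hswap : ∫ x, 𝓕 G x • f x = ∫ x, G x • 𝓕 (f : E → F) x := by
    simpa only [flip_innerₗ, SchwartzMap.fourier_coe] using!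
      VectorFourier.integral_fourierIntegral_smul_eq_flip (L := innerₗ E)
        Real.continuous_fourierChar continuous_inner (G.integrable (μ := volume)) hf
  exact hdual.symm.trans hswap

theorem lintegral_enorm_fourier_sq {q : E → F} (hq1 : Integrable q) (hq2 : MemLp q 2) :
    ∫⁻ s, ‖𝓕 q s‖ₑ ^ 2 = ∫⁻ t, ‖q t‖ₑ ^ 2 := by
  have hq : hq2.toLp q =ᵐ[volume] q := hq2.coeFn_toLp
  have hfourier : (𝓕 (hq2.toLp q) : Lp F 2 (volume : Measure E)) =ᵐ[volume] 𝓕 q := by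
    rw [← funext (Real.fourier_congr_ae hq)]
    exact coeFn_fourier_ae_eq _ (hq1.congr hq.symm)
  rw [← eLpNorm_two_sq, ← eLpNorm_two_sq, ← eLpNorm_congr_ae hfourier, ← eLpNorm_congr_ae hq,
    ← Lp.enorm_def, ← Lp.enorm_def, ← ofReal_norm, ← ofReal_norm, Lp.norm_fourier_eq]

end Plancherel

theorem lintegral_lintegral_mul_add {G : Type*} [MeasurableSpace G] [AddGroup G] [MeasurableAdd₂ G]
    {μ : Measure G} [SFinite μ] [μ.IsAddLeftInvariant] {u v : G → ℝ≥0∞} (hu : Measurable u)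
    (hv : Measurable v) :
    ∫⁻ y, ∫⁻ x, u x * v (x + y) ∂μ ∂μ = (∫⁻ x, u x ∂μ) * ∫⁻ x, v x ∂μ := by
  rw [lintegral_lintegral_swap (by fun_prop)]
  calc ∫⁻ x, ∫⁻ y, u x * v (x + y) ∂μ ∂μ = ∫⁻ x, u x * ∫⁻ y, v y ∂μ ∂μ :=
        lintegral_congr fun x => by
          rw [lintegral_const_mul _ (by fun_prop), lintegral_add_left_eq_self]
    _ = (∫⁻ x, u x ∂μ) * ∫⁻ x, v x ∂μ := lintegral_mul_const _ hu

theorem shift_add (z : ℝ × ℝ) (f g : L2) : shift z (f + g) = shift z f + shift z g := by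
  rw [shift, shift, shift, ← MemLp.toLp_add, MemLp.toLp_eq_toLp_iff]
  filter_upwards [(quasiMeasurePreserving_add_right volume z.1).ae (Lp.coeFn_add f g)] with t ht
  simp only [shiftFun, Pi.add_apply] at ht ⊢
  rw [ht, mul_add]

theorem shift_smul (z : ℝ × ℝ) (c : ℂ) (f : L2) : shift z (c • f) = c • shift z f := by
  rw [shift, shift, ← MemLp.toLp_const_smul, MemLp.toLp_eq_toLp_iff]
  filter_upwards [(quasiMeasurePreserving_add_right volume z.1).ae (Lp.coeFn_smul c f)] with t ht
  simp only [shiftFun, Pi.smul_apply, smul_eq_mul] at ht ⊢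
  rw [ht, mul_left_comm]

theorem norm_gabor_eq_norm_fourier {φ f : L2} {p g : ℝ → ℂ} (hp : φ =ᵐ[volume] p)
    (hg : f =ᵐ[volume] g) (z : ℝ × ℝ) :
    ‖gabor φ f z‖ = ‖𝓕 (fun t => g t * (starRingEnd ℂ) (p (t + z.1))) z.2‖ := by
  have hphase : gabor φ f z = Complex.exp (((-(Real.pi * z.1 * z.2) : ℝ) : ℂ) * Complex.I) *
      𝓕 (fun t => g t * (starRingEnd ℂ) (p (t + z.1))) z.2 := by
    rw [gabor_eq_integral, Real.fourier_real_eq, ← integral_const_mul]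
    refine integral_congr_ae ?_
    filter_upwards [(quasiMeasurePreserving_add_right volume z.1).ae hp, hg] with t h1 h2
    rw [h2, shiftFun, h1, Circle.smul_def, Real.fourierChar_apply, smul_eq_mul]
    simp only [map_mul, ← Complex.exp_conj, Complex.conj_ofReal, Complex.conj_I, map_ofNat]
    push_cast
    ring_nf
  rw [hphase, norm_mul, Complex.norm_exp_ofReal_mul_I, one_mul]

theorem lintegral_enorm_gabor_sq (φ f : L2) :
    ∫⁻ z, ‖gabor φ f z‖ₑ ^ 2 = ‖φ‖ₑ ^ 2 * ‖f‖ₑ ^ 2 := by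
  let q : ℝ → ℝ → ℂ := fun τ t => f t * (starRingEnd ℂ) (φ (t + τ))
  have hfm : Measurable (f : ℝ → ℂ) := (Lp.stronglyMeasurable f).measurable
  have hφm : Measurable (φ : ℝ → ℂ) := (Lp.stronglyMeasurable φ).measurable
  have hconj (τ : ℝ) : MemLp (fun t => (starRingEnd ℂ) (φ (t + τ))) 2 :=
    ((Lp.memLp φ).comp_measurePreserving (measurePreserving_add_right volume τ)).star
  have hq : ∫⁻ τ, ∫⁻ t, ‖q τ t‖ₑ ^ 2 = ‖φ‖ₑ ^ 2 * ‖f‖ₑ ^ 2 := by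
    simp only [q, enorm_mul, RCLike.enorm_conj, mul_pow]
    rw [lintegral_lintegral_mul_add (u := fun t => ‖f t‖ₑ ^ 2) (v := fun t => ‖φ t‖ₑ ^ 2)
      (by fun_prop) (by fun_prop), ← enorm_Lp_two_sq, ← enorm_Lp_two_sq, mul_comm]
  have hqm : Measurable (Function.uncurry q) := by
    have : Measurable (starRingEnd ℂ) := Complex.continuous_conj.measurable
    fun_prop
  have hfinite : ∀ᵐ τ, ∫⁻ t, ‖q τ t‖ₑ ^ 2 < ⊤ :=
    ae_lt_top (Measurable.lintegral_prod_right (hqm.enorm.pow_const 2)) (by rw [hq]; finiteness)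
  rw [← hq, Measure.volume_eq_prod, lintegral_prod _
    ((stronglyMeasurable_gabor φ f).measurable.enorm.pow_const 2).aemeasurable]
  refine lintegral_congr_ae ?_
  filter_upwards [hfinite] with τ hτ
  have hq2 : MemLp (q τ) 2 :=
    ⟨by fun_prop, by simpa only [← eLpNorm_two_sq, ENNReal.pow_lt_top_iff, two_ne_zero, or_false]
      using hτ⟩
  have hq1 : Integrable (q τ) := (Lp.memLp f).integrable_mul (hconj τ)
  rw [← lintegral_enorm_fourier_sq hq1 hq2]
  refine lintegral_congr fun s => ?_
  rw [← ofReal_norm, norm_gabor_eq_norm_fourier .rfl .rfl, ofReal_norm]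

/-- The Hilbert space of square integrable functions on the time-frequency plane. -/
abbrev PhaseL2 : Type := Lp ℂ 2 (volume : Measure (ℝ × ℝ))

theorem eLpNorm_gabor (φ f : L2) : eLpNorm (gabor φ f) 2 volume = ‖φ‖ₑ * ‖f‖ₑ := by
  refine (ENNReal.pow_right_strictMono two_ne_zero).injective ?_
  simp only [eLpNorm_two_sq, lintegral_enorm_gabor_sq, mul_pow]

theorem memLp_gabor (φ f : L2) : MemLp (gabor φ f) 2 :=
  ⟨(stronglyMeasurable_gabor φ f).aestronglyMeasurable, by
    rw [eLpNorm_gabor]; finiteness⟩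

theorem norm_toLp_gabor (φ f : L2) : ‖(memLp_gabor φ f).toLp‖ = ‖φ‖ * ‖f‖ := by
  simp only [Lp.norm_toLp, eLpNorm_gabor, ENNReal.toReal_mul, toReal_enorm]

/-- The Gabor transform as a bounded operator `L²(ℝ) → L²(ℝ²)` depending conjugate linearly on
the window. -/
def gaborL : L2 →L⋆[ℂ] L2 →L[ℂ] PhaseL2 :=
  (LinearMap.mk₂'ₛₗ (starRingEnd ℂ) (RingHom.id ℂ) (fun φ f => (memLp_gabor φ f).toLp)
    (fun φ ψ f => by
      rw [← MemLp.toLp_add]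
      congr 1; ext z; simp only [gabor, shift_add, inner_add_left, Pi.add_apply])
    (fun c φ f => by
      rw [← MemLp.toLp_const_smul]
      congr 1; ext z; simp only [gabor, shift_smul, inner_smul_left, Pi.smul_apply, smul_eq_mul])
    (fun φ f g => by
      rw [← MemLp.toLp_add]
      congr 1; ext z; simp only [gabor, inner_add_right, Pi.add_apply])
    (fun c φ f => by
      rw [← MemLp.toLp_const_smul]
      congr 1; ext z; simp only [gabor, inner_smul_right, Pi.smul_apply, smul_eq_mul,
        RingHom.id_apply])).mkContinuous₂ 1
    fun φ f => (norm_toLp_gabor φ f).le.trans_eq (by rw [one_mul])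

theorem coeFn_gaborL (φ f : L2) : gaborL φ f =ᵐ[volume] gabor φ f :=
  (memLp_gabor φ f).coeFn_toLp

theorem norm_gaborL_apply (φ f : L2) : ‖gaborL φ f‖ = ‖φ‖ * ‖f‖ :=
  norm_toLp_gabor φ f

section Decay

theorem abs_pow_mul_norm_fourier_le {E : Type*} [NormedAddCommGroup E] [NormedSpace ℂ E]
    {q : ℝ → E} {n : ℕ} (hq : ContDiff ℝ n q)
    (hint : ∀ k ≤ n, Integrable (iteratedDeriv k q)) (s : ℝ) :
    |s| ^ n * ‖𝓕 q s‖ ≤ ∫ t, ‖iteratedDeriv n q t‖ := by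
  calc |s| ^ n * ‖𝓕 q s‖ ≤ ‖(2 * Real.pi * Complex.I * s) ^ n • 𝓕 q s‖ := by
        rw [norm_smul]
        gcongr
        simp only [norm_pow, norm_mul, Complex.norm_ofNat, Complex.norm_real, Complex.norm_I,
          Real.norm_eq_abs, abs_of_pos Real.pi_pos, mul_one]
        gcongr
        exact le_mul_of_one_le_left (abs_nonneg s) (by linarith [Real.pi_gt_three])
    _ = ‖𝓕 (iteratedDeriv n q) s‖ := by
        rw [Real.fourier_iteratedDeriv (N := n) (mod_cast hq)
          (fun k hk => hint k (mod_cast hk)) le_rfl]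
    _ ≤ ∫ t, ‖iteratedDeriv n q t‖ :=
        VectorFourier.norm_fourierIntegral_le_integral_norm _ _ _ _ _

variable {u v : ℝ → ℂ}

theorem hasCompactSupport_iteratedDeriv (hu : HasCompactSupport u) (n : ℕ) :
    HasCompactSupport (iteratedDeriv n u) := by
  rw [iteratedDeriv_eq_equiv_comp]
  exact (hu.iteratedFDeriv n).comp_left (map_zero _)

theorem exists_norm_iteratedDeriv_mul_translate_le {n : ℕ} (hu : HasCompactSupport u)
    (hu' : ContDiff ℝ n u) (hv : HasCompactSupport v) (hv' : ContDiff ℝ n v) :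
    ∃ M : ℝ → ℝ, Integrable M ∧
      ∀ τ t, ‖iteratedDeriv n (fun t => u t * v (t + τ)) t‖ ≤ M t := by
  have hbound (k : ℕ) (hk : k ≤ n) : ∃ C, ∀ t, ‖iteratedDeriv k v t‖ ≤ C :=
    (hasCompactSupport_iteratedDeriv hv k).exists_bound_of_continuous
      (hv'.continuous_iteratedDeriv k (mod_cast hk))
  choose! C hC using hbound
  refine ⟨fun t => ∑ i ∈ Finset.range (n + 1),
    (n.choose i : ℝ) * ‖iteratedDeriv i u t‖ * C (n - i),
    integrable_finsetSum _ fun i hi => ?_, fun τ t => ?_⟩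
  · have hin : i ≤ n := Nat.lt_succ_iff.1 (Finset.mem_range.1 hi)
    exact (((hu'.continuous_iteratedDeriv i (mod_cast hin)).integrable_of_hasCompactSupport
      (hasCompactSupport_iteratedDeriv hu i)).norm.const_mul _).mul_const _
  · have hvτ : ContDiff ℝ n fun t => v (t + τ) := hv'.comp (by fun_prop)
    have hleibniz := norm_iteratedFDeriv_mul_le hu' hvτ t le_rfl
    simp only [norm_iteratedFDeriv_eq_norm_iteratedDeriv, iteratedDeriv_comp_add_const]
      at hleibniz
    refine hleibniz.trans (Finset.sum_le_sum fun i _ => ?_)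
    gcongr
    exact hC _ (Nat.sub_le n i) _

theorem exists_abs_pow_mul_norm_fourier_mul_translate_le (n : ℕ) (hu : HasCompactSupport u)
    (hu' : ContDiff ℝ n u) (hv : HasCompactSupport v) (hv' : ContDiff ℝ n v) :
    ∃ C, ∀ τ s, |s| ^ n * ‖𝓕 (fun t => u t * v (t + τ)) s‖ ≤ C := by
  obtain ⟨M, hM, hle⟩ := exists_norm_iteratedDeriv_mul_translate_le hu hu' hv hv'
  refine ⟨∫ t, M t, fun τ s => ?_⟩
  have hq : ContDiff ℝ n fun t => u t * v (t + τ) := hu'.mul (hv'.comp (by fun_prop))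
  have hint (k : ℕ) (hk : k ≤ n) : Integrable (iteratedDeriv k fun t => u t * v (t + τ)) :=
    (hq.continuous_iteratedDeriv k (mod_cast hk)).integrable_of_hasCompactSupport
      (hasCompactSupport_iteratedDeriv hu.mul_right k)
  exact (abs_pow_mul_norm_fourier_le hq hint s).trans
    (integral_mono (hint n le_rfl).norm hM (hle τ))

end Decay

/-- The classes of `C²` functions with compact support, a dense set of windows whose short-time
Fourier transform is integrable. -/
def testWindows : Set L2 :=
  {φ | ∃ p : ℝ → ℂ, φ =ᵐ[volume] p ∧ HasCompactSupport p ∧ ContDiff ℝ 2 p}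

theorem dense_testWindows : Dense testWindows :=
  (Lp.dense_hasCompactSupport_contDiff (p := 2) ENNReal.ofNat_ne_top).mono <| by
    rintro φ ⟨p, hp, hc, hd⟩
    exact ⟨p, hp, hc, hd.of_le (WithTop.coe_le_coe.2 le_top)⟩

theorem integrable_gabor_of_testWindows {φ f : L2} (hφ : φ ∈ testWindows) (hf : f ∈ testWindows) :
    Integrable (gabor φ f) := by
  obtain ⟨p, hp, hpc, hpd⟩ := hφ
  obtain ⟨g, hg, hgc, hgd⟩ := hf
  let p' : ℝ → ℂ := fun t => (starRingEnd ℂ) (p t)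
  have hpc' : HasCompactSupport p' := hpc.comp_left (map_zero _)
  have hpd' : ContDiff ℝ 2 p' := Complex.conjCLE.contDiff.comp hpd
  obtain ⟨C₀, h₀⟩ := exists_abs_pow_mul_norm_fourier_mul_translate_le 0 hgc
    (hgd.of_le zero_le_two) hpc' (hpd'.of_le zero_le_two)
  obtain ⟨C₂, h₂⟩ := exists_abs_pow_mul_norm_fourier_mul_translate_le 2 hgc hgd hpc' hpd'
  let K : Set ℝ := tsupport p + -tsupport g
  have hK : IsCompact K := hpc.isCompact.add hgc.isCompact.neg
  have hdom : Integrable fun z : ℝ × ℝ => K.indicator 1 z.1 * ((C₀ + C₂) * (1 + z.2 ^ 2)⁻¹) :=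
    Integrable.mul_prod ((integrable_indicator_iff hK.measurableSet).2
      (integrableOn_const hK.measure_ne_top)) (integrable_inv_one_add_sq.const_mul _)
  refine hdom.mono' (stronglyMeasurable_gabor φ f).aestronglyMeasurable
    (Eventually.of_forall fun z => ?_)
  rw [norm_gabor_eq_norm_fourier hp hg]
  by_cases hz : z.1 ∈ K
  · simp only [indicator_of_mem hz, Pi.one_apply, one_mul]
    rw [← div_eq_mul_inv, le_div_iff₀ (by positivity)]
    linarith [h₀ z.1 z.2, sq_abs z.2 ▸ h₂ z.1 z.2]
  · have hvanish : (fun t => g t * (starRingEnd ℂ) (p (t + z.1))) = 0 := by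
      funext t
      by_contra hne
      obtain ⟨hgt, hpt⟩ := mul_ne_zero_iff.1 hne
      exact hz ⟨t + z.1, subset_tsupport p ((map_ne_zero _).1 hpt), -t,
        neg_mem_neg.2 (subset_tsupport g hgt), add_neg_cancel_comm t z.1⟩
    rw [hvanish, indicator_of_notMem hz, zero_mul, Real.fourier_eq]
    simp only [Pi.zero_apply, smul_zero, integral_zero, norm_zero, le_refl]

theorem norm_gabor_shift (φ f : L2) (w z : ℝ × ℝ) :
    ‖gabor φ (shift w f) z‖ = ‖gabor φ f (z - w)‖ := by
  have hphase : gabor φ (shift w f) z =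
      Complex.exp (((Real.pi * (w.1 * z.2 - z.1 * w.2) : ℝ) : ℂ) * Complex.I) *
        gabor φ f (z - w) := by
    have hshift : ∫ t, shift w f t * (starRingEnd ℂ) (shiftFun z φ t) =
        ∫ t, shiftFun w f t * (starRingEnd ℂ) (shiftFun z φ t) := by
      refine integral_congr_ae ?_
      filter_upwards [(memLp_shiftFun w f).coeFn_toLp] with t ht
      rw [shift, ht]
    rw [gabor_eq_integral, gabor_eq_integral, hshift, ← integral_const_mul,
      ← integral_sub_right_eq_self _ w.1]
    congr 1
    funext t
    have hexp (a b c d e g h : ℂ) (H : a + b + c + d = e + g + h) :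
        Complex.exp a * Complex.exp b * (Complex.exp c * Complex.exp d) =
          Complex.exp e * (Complex.exp g * Complex.exp h) := by
      simp only [← Complex.exp_add, ← add_assoc, H]
    have harg : t - w.1 + z.1 = t + (z.1 - w.1) := by ring
    simp only [shiftFun, map_mul, ← Complex.exp_conj, Complex.conj_ofReal, Complex.conj_I,
      map_ofNat, sub_add_cancel, Prod.fst_sub, Prod.snd_sub, harg]
    rw [mul_mul_mul_comm, hexp _ _ _ _ (((Real.pi * (w.1 * z.2 - z.1 * w.2) : ℝ) : ℂ) * Complex.I)
      (Real.pi * -Complex.I * (z.1 - w.1 : ℝ) * (z.2 - w.2 : ℝ))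
      (2 * Real.pi * -Complex.I * (z.2 - w.2 : ℝ) * t) (by push_cast; ring)]
    ring
  rw [hphase, norm_mul, Complex.norm_exp_ofReal_mul_I, one_mul]

section Young

theorem sq_lintegral_mul_le {α : Type*} [MeasurableSpace α] {μ : Measure α} {k w : α → ℝ≥0∞}
    (hk : AEMeasurable k μ) (hw : AEMeasurable w μ) :
    (∫⁻ x, k x * w x ∂μ) ^ 2 ≤ (∫⁻ x, k x ∂μ) * ∫⁻ x, k x * w x ^ 2 ∂μ := by
  have hsqrt (a : ℝ≥0∞) : a ^ (1 / 2 : ℝ) * a ^ (1 / 2 : ℝ) = a := by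
    rw [← ENNReal.rpow_add_of_nonneg _ _ (by norm_num) (by norm_num), add_halves, ENNReal.rpow_one]
  have hcauchy := ENNReal.lintegral_mul_le_Lp_mul_Lq μ Real.HolderConjugate.two_two
    (hk.pow_const (1 / 2 : ℝ)) ((hk.pow_const (1 / 2 : ℝ)).mul hw)
  simp only [Pi.mul_apply, ENNReal.rpow_ofNat, mul_pow, ← mul_assoc, hsqrt] at hcauchy
  simp only [sq (_ ^ (1 / 2 : ℝ)), hsqrt] at hcauchy
  calc _ ≤ _ := pow_le_pow_left₀ zero_le hcauchy 2
    _ = _ := by rw [mul_pow, sq (_ ^ (1 / 2 : ℝ)), sq (_ ^ (1 / 2 : ℝ)), hsqrt, hsqrt]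

variable {G : Type*} [MeasurableSpace G] [AddGroup G] [MeasurableAdd₂ G] [MeasurableNeg G]
  {μ : Measure G} [SFinite μ]

theorem lintegral_sq_convolution_le [μ.IsAddLeftInvariant] [μ.IsNegInvariant]
    [μ.IsAddRightInvariant] {k w : G → ℝ≥0∞} (hk : Measurable k) (hw : Measurable w) :
    ∫⁻ x, (∫⁻ y, k (y - x) * w y ∂μ) ^ 2 ∂μ ≤ (∫⁻ x, k x ∂μ) ^ 2 * ∫⁻ x, w x ^ 2 ∂μ := by
  calc ∫⁻ x, (∫⁻ y, k (y - x) * w y ∂μ) ^ 2 ∂μ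
      ≤ ∫⁻ x, (∫⁻ y, k y ∂μ) * ∫⁻ y, k (y - x) * w y ^ 2 ∂μ ∂μ := lintegral_mono fun x => by
        rw [← lintegral_sub_right_eq_self k x]
        exact sq_lintegral_mul_le (by fun_prop) hw.aemeasurable
    _ = (∫⁻ x, k x ∂μ) * ∫⁻ y, (∫⁻ x, k (y - x) ∂μ) * w y ^ 2 ∂μ := by
        have hkw : Measurable fun q : G × G => k (q.2 - q.1) * w q.2 ^ 2 := by fun_prop
        rw [lintegral_const_mul _ hkw.lintegral_prod_right',
          lintegral_lintegral_swap hkw.aemeasurable]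
        congr! 3 with y
        exact lintegral_mul_const (w y ^ 2) (show Measurable fun x => k (y - x) by fun_prop)
    _ = (∫⁻ x, k x ∂μ) ^ 2 * ∫⁻ x, w x ^ 2 ∂μ := by
        simp only [lintegral_sub_left_eq_self k]
        rw [lintegral_const_mul _ (hw.pow_const 2), sq, mul_assoc]

end Young

theorem tendsto_setLIntegral_norm_ge {E : Type*} [NormedAddCommGroup E] [MeasurableSpace E]
    [OpensMeasurableSpace E] {μ : Measure E} {k : E → ℝ≥0∞} (hk : ∫⁻ x, k x ∂μ ≠ ⊤) :
    Tendsto (fun R : ℝ => ∫⁻ x in {x | R ≤ ‖x‖}, k x ∂μ) atTop (𝓝 0) := by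
  have hmeas (R : ℝ) : MeasurableSet {x : E | R ≤ ‖x‖} :=
    (isClosed_le continuous_const continuous_norm).measurableSet
  have hempty : ⋂ R : ℝ, {x : E | R ≤ ‖x‖} = ∅ := by
    ext x
    simpa only [mem_iInter, mem_ofPred_eq, mem_empty_iff_false, iff_false, not_forall, not_le]
      using exists_gt ‖x‖
  have htends := tendsto_measure_iInter_atTop (μ := μ.withDensity k)
    (fun R => (hmeas R).nullMeasurableSet) (fun _ _ hRS _ hx => hRS.trans hx)
    ⟨0, ((measure_mono (subset_univ _)).trans_lt (by simpa using hk.lt_top)).ne⟩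
  simpa only [hempty, measure_empty, Function.comp_def, withDensity_apply _ (hmeas _)] using htends

/-- The Gabor transform restricted to a region `D` of the time-frequency plane, as a bounded
operator `L²(ℝ) → L²(D)`. -/
def localGabor (φ : L2) (D : Set (ℝ × ℝ)) : L2 →L[ℂ] Lp ℂ 2 (volume.restrict D) :=
  LpToLpRestrictCLM (ℝ × ℝ) ℂ ℂ volume 2 D ∘L gaborL φ

theorem coeFn_localGabor (φ : L2) (D : Set (ℝ × ℝ)) (f : L2) :
    localGabor φ D f =ᵐ[volume.restrict D] gabor φ f :=
  (LpToLpRestrictCLM_coeFn ℂ D (gaborL φ f)).trans (ae_restrict_of_ae (coeFn_gaborL φ f))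

theorem localGabor_sub (φ ψ : L2) (D : Set (ℝ × ℝ)) :
    localGabor (φ - ψ) D = localGabor φ D - localGabor ψ D := by
  simp only [localGabor, map_sub, ContinuousLinearMap.comp_sub]

theorem norm_localGabor_le (φ : L2) (D : Set (ℝ × ℝ)) : ‖localGabor φ D‖ ≤ ‖φ‖ :=
  ContinuousLinearMap.opNorm_le_bound _ (norm_nonneg φ) fun f =>
    (norm_Lp_toLp_restrict_le D (gaborL φ f)).trans_eq (norm_gaborL_apply φ f)

theorem enorm_localGabor_sq (φ : L2) (D : Set (ℝ × ℝ)) (f : L2) :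
    ‖localGabor φ D f‖ₑ ^ 2 = ∫⁻ z in D, ‖gabor φ f z‖ₑ ^ 2 := by
  rw [enorm_Lp_two_sq]
  refine lintegral_congr_ae ?_
  filter_upwards [coeFn_localGabor φ D f] with z hz
  rw [hz]

theorem inner_localGabor (φ : L2) (D : Set (ℝ × ℝ)) (f : L2) (W : Lp ℂ 2 (volume.restrict D)) :
    inner ℂ (localGabor φ D f) W = ∫ z in D, W z * (starRingEnd ℂ) (gabor φ f z) := by
  rw [L2.inner_def]
  refine integral_congr_ae ?_
  filter_upwards [coeFn_localGabor φ D f] with z hz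
  rw [hz, RCLike.inner_apply]

theorem energyForm_eq_inner_localGabor (φ : L2) (D : Set (ℝ × ℝ)) (f g : L2) :
    energyForm φ D f g = inner ℂ (localGabor φ D g) (localGabor φ D f) := by
  rw [inner_localGabor, energyForm]
  refine integral_congr_ae ?_
  filter_upwards [coeFn_localGabor φ D f] with z hz
  rw [hz, inner_shift_eq]

theorem inner_concentrationOp_eq_energyForm (φ : L2) (D : Set (ℝ × ℝ)) (f g : L2) :
    inner ℂ g (concentrationOp φ D f) = energyForm φ D f g := by
  have hT : ∃ T : L2 →L[ℂ] L2, ∀ f g, inner ℂ g (T f) = energyForm φ D f g :=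
    ⟨(localGabor φ D)† ∘L localGabor φ D, fun f g => by
      rw [ContinuousLinearMap.comp_apply, ContinuousLinearMap.adjoint_inner_right,
        energyForm_eq_inner_localGabor]⟩
  rw [concentrationOp, dif_pos hT, hT.choose_spec]

theorem concentrationOp_eq_adjoint_comp (φ : L2) (D : Set (ℝ × ℝ)) :
    concentrationOp φ D = (localGabor φ D)† ∘L localGabor φ D := by
  ext1 f
  refine ext_inner_left ℂ fun g => ?_
  rw [inner_concentrationOp_eq_energyForm, energyForm_eq_inner_localGabor,
    ContinuousLinearMap.comp_apply, ContinuousLinearMap.adjoint_inner_right]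

theorem isPositive_concentrationOp (φ : L2) (D : Set (ℝ × ℝ)) :
    (concentrationOp φ D).IsPositive := by
  rw [concentrationOp_eq_adjoint_comp]
  exact ContinuousLinearMap.isPositive_adjoint_comp_self _

theorem energyForm_add_compl (φ : L2) {D : Set (ℝ × ℝ)} (hD : MeasurableSet D) (f g : L2) :
    energyForm φ D f g + energyForm φ Dᶜ f g = inner ℂ (gaborL φ g) (gaborL φ f) := by
  have henergy : (fun z => gabor φ f z * inner ℂ g (shift z φ)) =ᵐ[volume]
      fun z => inner ℂ (gaborL φ g z) (gaborL φ f z) := by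
    filter_upwards [coeFn_gaborL φ f, coeFn_gaborL φ g] with z hf hg
    rw [hf, hg, inner_shift_eq, RCLike.inner_apply]
  rw [energyForm, energyForm,
    integral_add_compl hD ((L2.integrable_inner _ _).congr henergy.symm),
    integral_congr_ae henergy, L2.inner_def]

theorem concentrationOp_add_compl {φ : L2} (hφ : ‖φ‖ = 1) {D : Set (ℝ × ℝ)}
    (hD : MeasurableSet D) : concentrationOp φ D + concentrationOp φ Dᶜ = 1 := by
  have hisometry (f g : L2) : inner ℂ (gaborL φ g) (gaborL φ f) = inner ℂ g f :=
    (LinearMap.norm_map_iff_inner_map_map (gaborL φ)).1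
      (fun f => by rw [norm_gaborL_apply, hφ, one_mul]) g f
  ext1 f
  refine ext_inner_left ℂ fun g => ?_
  rw [add_apply, inner_add_right, inner_concentrationOp_eq_energyForm,
    inner_concentrationOp_eq_energyForm, energyForm_add_compl φ hD, hisometry, one_apply_eq_self]

theorem gabor_adjoint_localGabor (φ : L2) (F : Set (ℝ × ℝ)) (W : Lp ℂ 2 (volume.restrict F))
    (z : ℝ × ℝ) : gabor φ (((localGabor φ F)†) W) z =
      ∫ w in F, W w * (starRingEnd ℂ) (gabor φ (shift z φ) w) := by
  rw [gabor, ContinuousLinearMap.adjoint_inner_right, inner_localGabor]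

theorem enorm_gabor_adjoint_localGabor_le (φ : L2) (F : Set (ℝ × ℝ))
    (W : Lp ℂ 2 (volume.restrict F)) (z : ℝ × ℝ) :
    ‖gabor φ (((localGabor φ F)†) W) z‖ₑ ≤ ∫⁻ w in F, ‖gabor φ φ (w - z)‖ₑ * ‖W w‖ₑ := by
  rw [gabor_adjoint_localGabor]
  refine (enorm_integral_le_lintegral_enorm _).trans_eq (lintegral_congr fun w => ?_)
  rw [enorm_mul, RCLike.enorm_conj, mul_comm, ← ofReal_norm (gabor φ _ w), norm_gabor_shift,
    ofReal_norm]

theorem measurable_enorm_gabor (φ f : L2) : Measurable fun z => ‖gabor φ f z‖ₑ :=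
  (stronglyMeasurable_gabor φ f).measurable.enorm

theorem enorm_localGabor_adjoint_localGabor_le (φ : L2) {E F : Set (ℝ × ℝ)}
    (hE : MeasurableSet E) (hF : MeasurableSet F) {R : ℝ}
    (hEF : ∀ z ∈ E, ∀ w ∈ F, R ≤ dist z w) (W : Lp ℂ 2 (volume.restrict F)) :
    ‖localGabor φ E (((localGabor φ F)†) W)‖ₑ ≤
      (∫⁻ x in {x | R ≤ ‖x‖}, ‖gabor φ φ x‖ₑ) * ‖W‖ₑ := by
  let far : Set (ℝ × ℝ) := {x | R ≤ ‖x‖}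
  have hfar : MeasurableSet far := measurableSet_le measurable_const measurable_norm
  let k : ℝ × ℝ → ℝ≥0∞ := far.indicator fun x => ‖gabor φ φ x‖ₑ
  let w : ℝ × ℝ → ℝ≥0∞ := F.indicator fun x => ‖W x‖ₑ
  have hk : Measurable k := (measurable_enorm_gabor φ φ).indicator hfar
  have hw : Measurable w := (Lp.stronglyMeasurable W).measurable.enorm.indicator hF
  have hconv (z : ℝ × ℝ) (hz : z ∈ E) :
      ‖gabor φ (((localGabor φ F)†) W) z‖ₑ ≤ ∫⁻ x, k (x - z) * w x := by
    refine (enorm_gabor_adjoint_localGabor_le φ F W z).trans_eq ?_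
    rw [← lintegral_indicator hF]
    refine lintegral_congr fun x => ?_
    by_cases hx : x ∈ F
    · have hxz : x - z ∈ far := by
        rw [mem_ofPred_eq, ← dist_eq_norm, dist_comm]
        exact hEF z hz x hx
      simp only [k, w, indicator_of_mem hx, indicator_of_mem hxz]
    · simp only [w, indicator_of_notMem hx, mul_zero]
  refine (ENNReal.pow_le_pow_left_iff two_ne_zero).1 ?_
  calc ‖localGabor φ E (((localGabor φ F)†) W)‖ₑ ^ 2
      = ∫⁻ z in E, ‖gabor φ (((localGabor φ F)†) W) z‖ₑ ^ 2 := enorm_localGabor_sq ..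
    _ ≤ ∫⁻ z in E, (∫⁻ x, k (x - z) * w x) ^ 2 :=
        setLIntegral_mono' hE fun z hz => pow_le_pow_left₀ zero_le (hconv z hz) 2
    _ ≤ ∫⁻ z, (∫⁻ x, k (x - z) * w x) ^ 2 := setLIntegral_le_lintegral _ _
    _ ≤ (∫⁻ x, k x) ^ 2 * ∫⁻ x, w x ^ 2 := lintegral_sq_convolution_le hk hw
    _ = ((∫⁻ x in far, ‖gabor φ φ x‖ₑ) * ‖W‖ₑ) ^ 2 := by
        rw [mul_pow, enorm_Lp_two_sq, lintegral_indicator hfar, ← lintegral_indicator hF]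
        congr 1
        refine lintegral_congr fun x => ?_
        by_cases hx : x ∈ F <;> simp [w, hx]

theorem exists_norm_localGabor_comp_adjoint_le_of_testWindows {φ : L2} (hφ : φ ∈ testWindows)
    {ε : ℝ} (hε : 0 < ε) :
    ∃ R > 0, ∀ E F : Set (ℝ × ℝ), MeasurableSet E → MeasurableSet F →
      (∀ z ∈ E, ∀ w ∈ F, R ≤ dist z w) →
        ‖localGabor φ E ∘L (localGabor φ F)†‖ ≤ ε := by
  have hint : ∫⁻ x, ‖gabor φ φ x‖ₑ ≠ ⊤ := (integrable_gabor_of_testWindows hφ hφ).2.ne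
  obtain ⟨R, htail, hR⟩ := (((tendsto_setLIntegral_norm_ge hint).eventually
    (ge_mem_nhds (ENNReal.ofReal_pos.2 hε))).and (eventually_gt_atTop 0)).exists
  refine ⟨R, hR, fun E F hE hF hEF => ContinuousLinearMap.opNorm_le_bound _ hε.le fun W => ?_⟩
  rw [← ENNReal.ofReal_le_ofReal_iff (by positivity), ENNReal.ofReal_mul hε.le, ofReal_norm,
    ofReal_norm]
  exact (enorm_localGabor_adjoint_localGabor_le φ hE hF hEF W).trans (by gcongr)

theorem norm_localGabor_comp_adjoint_sub_le (φ ψ : L2) (E F : Set (ℝ × ℝ)) :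
    ‖localGabor φ E ∘L (localGabor φ F)† - localGabor ψ E ∘L (localGabor ψ F)†‖ ≤
      (‖φ‖ + ‖ψ‖) * ‖φ - ψ‖ := by
  have hnorm (χ χ' : L2) : ‖localGabor χ E ∘L (localGabor χ' F)†‖ ≤ ‖χ‖ * ‖χ'‖ :=
    (ContinuousLinearMap.opNorm_comp_le _ _).trans <| by
      rw [LinearIsometryEquiv.norm_map]
      gcongr <;> exact norm_localGabor_le _ _
  calc ‖localGabor φ E ∘L (localGabor φ F)† - localGabor ψ E ∘L (localGabor ψ F)†‖
      = ‖localGabor φ E ∘L (localGabor (φ - ψ) F)† +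
          localGabor (φ - ψ) E ∘L (localGabor ψ F)†‖ := by
        simp only [localGabor_sub, map_sub, ContinuousLinearMap.comp_sub,
          ContinuousLinearMap.sub_comp, sub_add_sub_cancel]
    _ ≤ ‖φ‖ * ‖φ - ψ‖ + ‖φ - ψ‖ * ‖ψ‖ := norm_add_le_of_le (hnorm _ _) (hnorm _ _)
    _ = (‖φ‖ + ‖ψ‖) * ‖φ - ψ‖ := by ring

theorem exists_norm_localGabor_comp_adjoint_le (φ : L2) {ε : ℝ} (hε : 0 < ε) :
    ∃ R > 0, ∀ E F : Set (ℝ × ℝ), MeasurableSet E → MeasurableSet F →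
      (∀ z ∈ E, ∀ w ∈ F, R ≤ dist z w) →
        ‖localGabor φ E ∘L (localGabor φ F)†‖ ≤ ε := by
  have htends : Tendsto (fun ψ => (‖φ‖ + ‖ψ‖) * ‖φ - ψ‖) (𝓝 φ) (𝓝 0) := by
    refine Continuous.tendsto' (by fun_prop) _ _ ?_
    rw [sub_self, norm_zero, mul_zero]
  obtain ⟨ψ, hclose, hψ⟩ :=
    mem_closure_iff_nhds.1 (dense_testWindows φ) _ (htends.eventually_le_const (half_pos hε))
  obtain ⟨R, hR, hψR⟩ :=
    exists_norm_localGabor_comp_adjoint_le_of_testWindows hψ (half_pos hε)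
  refine ⟨R, hR, fun E F hE hF hEF => ?_⟩
  calc ‖localGabor φ E ∘L (localGabor φ F)†‖
      ≤ ‖localGabor φ E ∘L (localGabor φ F)† - localGabor ψ E ∘L (localGabor ψ F)†‖ +
          ‖localGabor ψ E ∘L (localGabor ψ F)†‖ := norm_le_norm_sub_add _ _
    _ ≤ ε / 2 + ε / 2 :=
        add_le_add ((norm_localGabor_comp_adjoint_sub_le φ ψ E F).trans hclose) (hψR E F hE hF hEF)
    _ = ε := add_halves ε

section OrthonormalCount

variable {𝕜 E ι : Type*} [RCLike 𝕜] [NormedAddCommGroup E] [InnerProductSpace 𝕜 E]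
  {V : ι → Submodule 𝕜 E}

theorem exists_orthonormal_of_natCast_le_rank {n : ℕ} (hn : (n : Cardinal) ≤ Module.rank 𝕜 E) :
    ∃ v : Fin n → E, Orthonormal 𝕜 v := by
  obtain ⟨v, hv⟩ := Module.le_rank_iff.1 hn
  exact ⟨_, InnerProductSpace.gramSchmidtNormed_orthonormal hv⟩

theorem exists_orthonormal_of_natCast_le_rank_of_orthogonalFamily
    (hV : OrthogonalFamily 𝕜 (fun i => V i) fun i => (V i).subtypeₗᵢ) {s : Finset ι} {n : ι → ℕ}
    (hn : ∀ i ∈ s, (n i : Cardinal) ≤ Module.rank 𝕜 (V i)) :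
    ∃ f : Fin (∑ i ∈ s, n i) → E, Orthonormal 𝕜 f ∧ ∀ k, ∃ i, f k ∈ V i := by
  choose v hv using fun i : s => exists_orthonormal_of_natCast_le_rank (hn i i.2)
  have hcard : Fintype.card (Σ i : s, Fin (n i)) = ∑ i ∈ s, n i := by
    rw [Fintype.card_sigma]
    simp only [Fintype.card_fin, Finset.sum_coe_sort s n]
  let e := (Fintype.equivFinOfCardEq hcard).symm
  exact ⟨_, ((hV.comp Subtype.val_injective).orthonormal_sigma_orthonormal hv).comp e e.injective,
    fun k => ⟨(e k).1, (v (e k).1 (e k).2).2⟩⟩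

theorem tsum_rank_le_of_orthonormal_card_le
    (hV : OrthogonalFamily 𝕜 (fun i => V i) fun i => (V i).subtypeₗᵢ) {M : ℝ≥0∞}
    (hM : ∀ (n : ℕ) (f : Fin n → E), Orthonormal 𝕜 f → (∀ k, ∃ i, f k ∈ V i) → (n : ℝ≥0∞) ≤ M) :
    ∑' i, ((Cardinal.toENat (Module.rank 𝕜 (V i)) : ℕ∞) : ℝ≥0∞) ≤ M := by
  have hsum (s : Finset ι) (n : ι → ℕ)
      (hn : ∀ i ∈ s, (n i : ℕ∞) ≤ Cardinal.toENat (Module.rank 𝕜 (V i))) :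
      ((∑ i ∈ s, n i : ℕ) : ℝ≥0∞) ≤ M := by
    obtain ⟨f, hf, hfV⟩ := exists_orthonormal_of_natCast_le_rank_of_orthogonalFamily hV
      fun i hi => Cardinal.natCast_le_toENat.1 (hn i hi)
    exact hM _ f hf hfV
  rcases eq_or_ne M ⊤ with rfl | hMtop
  · exact le_top
  have hfinite (i : ι) : Cardinal.toENat (Module.rank 𝕜 (V i)) ≠ ⊤ := fun htop => by
    obtain ⟨N, hN⟩ := ENNReal.exists_nat_gt hMtop
    refine hN.not_ge ?_
    simpa only [Finset.sum_singleton] using hsum {i} (fun _ => N) fun j hj => by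
      rw [Finset.mem_singleton.1 hj, htop]
      exact le_top
  choose k hk using fun i => ENat.ne_top_iff_exists.1 (hfinite i)
  rw [ENNReal.tsum_eq_iSup_sum]
  refine iSup_le fun s => ?_
  simpa only [← hk, ENat.toENNReal_coe, Nat.cast_sum] using hsum s k fun i _ => (hk i).le

end OrthonormalCount

theorem eigenvalueCount_le_of_orthonormal_card_le {T : L2 →L[ℂ] L2}
    (hT : (T : L2 →ₗ[ℂ] L2).IsSymmetric) {a b : ℝ} {M : ℝ≥0∞}
    (hM : ∀ (n : ℕ) (f : Fin n → L2), Orthonormal ℂ f →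
      (∀ k, ∃ ν ∈ Icc a b, T (f k) = (ν : ℂ) • f k) → (n : ℝ≥0∞) ≤ M) :
    eigenvalueCount T a b ≤ M :=
  tsum_rank_le_of_orthonormal_card_le
    (hT.orthogonalFamily_eigenspaces.comp
      (Complex.ofReal_injective.comp Subtype.val_injective : Function.Injective
        fun ν : Icc a b => ((ν : ℝ) : ℂ)))
    fun n f hf hfV => hM n f hf fun k =>
      let ⟨ν, hν⟩ := hfV k
      ⟨ν, ν.2, Module.End.mem_eigenspace_iff.1 hν⟩

theorem norm_localGabor_sq_inter_add_sdiff (φ f : L2) (D : Set (ℝ × ℝ)) {N : Set (ℝ × ℝ)}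
    (hN : MeasurableSet N) :
    ‖localGabor φ (D ∩ N) f‖ ^ 2 + ‖localGabor φ (D \ N) f‖ ^ 2 = ‖localGabor φ D f‖ ^ 2 := by
  have hsplit : ‖localGabor φ (D ∩ N) f‖ₑ ^ 2 + ‖localGabor φ (D \ N) f‖ₑ ^ 2 =
      ‖localGabor φ D f‖ₑ ^ 2 := by
    simp only [enorm_localGabor_sq]
    exact lintegral_inter_add_sdiff _ D hN
  simpa only [ENNReal.toReal_add (ENNReal.pow_ne_top enorm_ne_top)
    (ENNReal.pow_ne_top enorm_ne_top), ENNReal.toReal_pow, toReal_enorm]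
    using congrArg ENNReal.toReal hsplit

theorem sum_enorm_gabor_sq_le (φ : L2) {ι : Type*} [Fintype ι] {f : ι → L2}
    (hf : Orthonormal ℂ f) (z : ℝ × ℝ) : ∑ i, ‖gabor φ (f i) z‖ₑ ^ 2 ≤ ‖φ‖ₑ ^ 2 := by
  have hbessel : ∑ i, ‖gabor φ (f i) z‖ ^ 2 ≤ ‖φ‖ ^ 2 := by
    simpa only [gabor, norm_inner_symm (shift z φ), norm_shift]
      using hf.sum_inner_products_le (shift z φ) (s := Finset.univ)
  simp only [← ofReal_norm, ← ENNReal.ofReal_pow (norm_nonneg _)]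
  rw [← ENNReal.ofReal_sum_of_nonneg fun i _ => by positivity]
  exact ENNReal.ofReal_le_ofReal hbessel

theorem sum_enorm_localGabor_sq_le (φ : L2) (N : Set (ℝ × ℝ)) {ι : Type*} [Fintype ι]
    {f : ι → L2} (hf : Orthonormal ℂ f) :
    ∑ i, ‖localGabor φ N (f i)‖ₑ ^ 2 ≤ ‖φ‖ₑ ^ 2 * volume N := by
  calc ∑ i, ‖localGabor φ N (f i)‖ₑ ^ 2 = ∫⁻ z in N, ∑ i, ‖gabor φ (f i) z‖ₑ ^ 2 := by
        rw [lintegral_finsetSum _ fun i _ => (measurable_enorm_gabor φ (f i)).pow_const 2]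
        simp only [enorm_localGabor_sq]
    _ ≤ ∫⁻ _ in N, ‖φ‖ₑ ^ 2 := lintegral_mono fun z => sum_enorm_gabor_sq_le φ hf z
    _ = ‖φ‖ₑ ^ 2 * volume N := setLIntegral_const N _

section Eigenvector

variable {φ f : L2} {D : Set (ℝ × ℝ)} {ν : ℝ}

theorem norm_localGabor_sq_of_eigenvector (hν : concentrationOp φ D f = (ν : ℂ) • f) :
    ‖localGabor φ D f‖ ^ 2 = ν * ‖f‖ ^ 2 := by
  have hinner : inner ℂ (localGabor φ D f) (localGabor φ D f) = (ν : ℂ) * inner ℂ f f := by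
    rw [← ContinuousLinearMap.adjoint_inner_right, ← ContinuousLinearMap.comp_apply,
      ← concentrationOp_eq_adjoint_comp, hν, inner_smul_right]
  refine Complex.ofReal_injective ?_
  simpa only [inner_self_eq_norm_sq_to_K, Complex.coe_algebraMap, Complex.ofReal_mul,
    Complex.ofReal_pow] using hinner

theorem smul_localGabor_of_eigenvector (hφ : ‖φ‖ = 1) (hD : MeasurableSet D)
    (hν : concentrationOp φ D f = (ν : ℂ) • f) (E : Set (ℝ × ℝ)) :
    ((1 - ν : ℝ) : ℂ) • localGabor φ E f =
      (localGabor φ E ∘L (localGabor φ Dᶜ)†) (localGabor φ Dᶜ f) := by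
  have hcompl : concentrationOp φ Dᶜ f = ((1 - ν : ℝ) : ℂ) • f := by
    rw [eq_sub_of_add_eq' (concentrationOp_add_compl hφ hD), sub_apply, hν, one_apply_eq_self,
      Complex.ofReal_sub, Complex.ofReal_one, sub_smul, one_smul]
  rw [← map_smul, ← hcompl, concentrationOp_eq_adjoint_comp]
  rfl

theorem norm_localGabor_le_of_eigenvector (hφ : ‖φ‖ = 1) (hD : MeasurableSet D)
    (hν : concentrationOp φ D f = (ν : ℂ) • f) (hν1 : ν < 1) {E : Set (ℝ × ℝ)} {δ : ℝ}
    (hE : ‖localGabor φ E ∘L (localGabor φ Dᶜ)†‖ ≤ (1 - ν) * δ) :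
    ‖localGabor φ E f‖ ≤ δ * ‖f‖ := by
  have hν0 : 0 < 1 - ν := sub_pos.2 hν1
  refine le_of_mul_le_mul_left ?_ hν0
  calc (1 - ν) * ‖localGabor φ E f‖
      = ‖(localGabor φ E ∘L (localGabor φ Dᶜ)†) (localGabor φ Dᶜ f)‖ := by
        rw [← smul_localGabor_of_eigenvector hφ hD hν, norm_smul, Complex.norm_real,
          Real.norm_of_nonneg hν0.le]
    _ ≤ (1 - ν) * δ * (1 * ‖f‖) := ContinuousLinearMap.le_of_opNorm_le_of_le _ hE <|
        ContinuousLinearMap.le_of_opNorm_le _ ((norm_localGabor_le φ _).trans_eq hφ) f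
    _ = (1 - ν) * (δ * ‖f‖) := by ring

theorem half_le_norm_localGabor_inter_sq_of_eigenvector (hφ : ‖φ‖ = 1) (hD : MeasurableSet D)
    (hf : ‖f‖ = 1) (hν : concentrationOp φ D f = (ν : ℂ) • f) (hν0 : 0 ≤ ν) (hν1 : ν < 1)
    {N : Set (ℝ × ℝ)} (hN : MeasurableSet N)
    (hfar : ‖localGabor φ (D \ N) ∘L (localGabor φ Dᶜ)†‖ ≤ (1 - ν) * √(ν / 2)) :
    ν / 2 ≤ ‖localGabor φ (D ∩ N) f‖ ^ 2 := by
  have hE := norm_localGabor_le_of_eigenvector hφ hD hν hν1 hfar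
  have hD' := norm_localGabor_sq_of_eigenvector hν
  have hE' : ‖localGabor φ (D \ N) f‖ ^ 2 ≤ ν / 2 := by
    calc ‖localGabor φ (D \ N) f‖ ^ 2 ≤ (√(ν / 2) * ‖f‖) ^ 2 := by gcongr
      _ = ν / 2 := by rw [hf, mul_one, Real.sq_sqrt (by positivity)]
  rw [← norm_localGabor_sq_inter_add_sdiff φ f D hN, hf] at hD'
  linarith

end Eigenvector

/-- The part of `Ω` at distance less than `ε` from its complement, an inner neighbourhood of the
boundary. -/
def collar {X : Type*} [PseudoEMetricSpace X] (ε : ℝ) (Ω : Set X) : Set X :=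
  Ω ∩ Metric.thickening ε Ωᶜ

theorem exists_eigenvalueCount_concentrationOp_le {φ : L2} (hφ : ‖φ‖ = 1) {lam mu : ℝ}
    (hlam : 0 < lam) (hmu : mu < 1) :
    ∃ R > 0, ∀ D : Set (ℝ × ℝ), MeasurableSet D →
      eigenvalueCount (concentrationOp φ D) lam mu ≤
        volume (collar R D) / ENNReal.ofReal (lam / 2) := by
  obtain ⟨R, hR, hfar⟩ := exists_norm_localGabor_comp_adjoint_le φ
    (ε := (1 - mu) * √(lam / 2)) (mul_pos (sub_pos.2 hmu) (by positivity))
  refine ⟨R, hR, fun D hD => ?_⟩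
  let N : Set (ℝ × ℝ) := Metric.thickening R Dᶜ
  have hN : MeasurableSet N := Metric.isOpen_thickening.measurableSet
  have hoff : ‖localGabor φ (D \ N) ∘L (localGabor φ Dᶜ)†‖ ≤ (1 - mu) * √(lam / 2) :=
    hfar _ _ (hD.diff hN) hD.compl fun z hz w hw =>
      not_lt.1 fun hzw => hz.2 (Metric.mem_thickening_iff.2 ⟨w, hw, hzw⟩)
  refine eigenvalueCount_le_of_orthonormal_card_le (isPositive_concentrationOp φ D).isSymmetric
    fun n f hf heigen => ?_
  have hnear (i : Fin n) : ENNReal.ofReal (lam / 2) ≤ ‖localGabor φ (D ∩ N) (f i)‖ₑ ^ 2 := by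
    obtain ⟨ν, hν, hfν⟩ := heigen i
    rw [← ofReal_norm, ← ENNReal.ofReal_pow (norm_nonneg _)]
    refine ENNReal.ofReal_le_ofReal ((div_le_div_of_nonneg_right hν.1 zero_le_two).trans ?_)
    exact half_le_norm_localGabor_inter_sq_of_eigenvector hφ hD (hf.1 i) hfν
      (hlam.le.trans hν.1) (hν.2.trans_lt hmu) hN (hoff.trans (by gcongr <;> grind))
  rw [ENNReal.le_div_iff_mul_le (Or.inl (by simpa using hlam)) (Or.inl ENNReal.ofReal_ne_top)]
  calc (n : ℝ≥0∞) * ENNReal.ofReal (lam / 2)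
      = ∑ _i : Fin n, ENNReal.ofReal (lam / 2) := by
        rw [Finset.sum_const, Finset.card_fin, nsmul_eq_mul]
    _ ≤ ∑ i, ‖localGabor φ (D ∩ N) (f i)‖ₑ ^ 2 := Finset.sum_le_sum fun i _ => hnear i
    _ ≤ ‖φ‖ₑ ^ 2 * volume (D ∩ N) := sum_enorm_localGabor_sq_le φ _ hf
    _ = volume (collar R D) := by
        rw [← ofReal_norm, hφ, ENNReal.ofReal_one, one_pow, one_mul, collar]

section Slices

theorem prod_apply_le_of_slice_le {α β : Type*} [MeasurableSpace α] [MeasurableSpace β]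
    {μ : Measure α} {ν : Measure β} [SFinite ν] {S : Set (α × β)} (hS : MeasurableSet S)
    {A : Set α} (hSA : ∀ z ∈ S, z.1 ∈ A) {D : ℝ≥0∞} (hD : ∀ a, ν (Prod.mk a ⁻¹' S) ≤ D) :
    μ.prod ν S ≤ D * μ A := by
  rw [Measure.prod_apply hS]
  refine (lintegral_mono fun a => ?_).trans (lintegral_indicator_const_le A D)
  by_cases ha : a ∈ A
  · rw [indicator_of_mem ha]
    exact hD a
  · have hempty : Prod.mk a ⁻¹' S = ∅ := eq_empty_of_forall_notMem fun b hb => ha (hSA (a, b) hb)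
    rw [hempty, measure_empty]
    exact zero_le

theorem volume_le_of_vertical_slices {S : Set (ℝ × ℝ)} (hS : MeasurableSet S) {x : ℝ × ℝ} {ρ : ℝ}
    (hSx : S ⊆ Metric.ball x ρ) {D : ℝ≥0∞}
    (hD : ∀ z ∈ S, ∀ z' ∈ S, ∀ a : ℝ, z - z' = a • (0, 1) → ENNReal.ofReal |a| ≤ D) :
    volume S ≤ D * ENNReal.ofReal (2 * ρ) := by
  rw [← Real.volume_ball x.1]
  refine prod_apply_le_of_slice_le hS (fun z hz => ?_) fun a =>
    (Real.volume_le_diam _).trans (Metric.ediam_le fun b hb b' hb' => ?_)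
  · exact (ball_prod_same x.1 x.2 ρ ▸ hSx hz : z ∈ Metric.ball x.1 ρ ×ˢ Metric.ball x.2 ρ).1
  · rw [edist_dist, Real.dist_eq]
    exact hD _ hb _ hb' (b - b') (by simp)

theorem volume_le_of_axis_slices {S : Set (ℝ × ℝ)} (hS : MeasurableSet S) {x : ℝ × ℝ} {ρ : ℝ}
    (hSx : S ⊆ Metric.ball x ρ) {e : ℝ × ℝ} (he : e = (1, 0) ∨ e = (0, 1)) {D : ℝ≥0∞}
    (hD : ∀ z ∈ S, ∀ z' ∈ S, ∀ a : ℝ, z - z' = a • e → ENNReal.ofReal |a| ≤ D) :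
    volume S ≤ D * ENNReal.ofReal (2 * ρ) := by
  rcases he with rfl | rfl
  · have hswap : MeasurePreserving (Prod.swap : ℝ × ℝ → ℝ × ℝ) volume volume :=
      Measure.measurePreserving_swap
    rw [← hswap.measure_preimage hS.nullMeasurableSet]
    refine volume_le_of_vertical_slices (x := x.swap) (measurable_swap hS) (fun z hz => ?_)
      fun z hz z' hz' a ha => hD _ hz _ hz' a (by simpa using congrArg Prod.swap ha)
    have hzx := hSx hz
    rw [← ball_prod_same] at hzx ⊢
    exact hzx.symm
  · exact volume_le_of_vertical_slices hS hSx hD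

end Slices

section Sublevel

theorem exists_axis_apply_ne_zero {L : ℝ × ℝ →L[ℝ] ℝ} (hL : L ≠ 0) :
    ∃ e : ℝ × ℝ, (e = (1, 0) ∨ e = (0, 1)) ∧ L e ≠ 0 := by
  contrapose! hL
  ext
  · simpa using hL (1, 0) (Or.inl rfl)
  · simpa using hL (0, 1) (Or.inr rfl)

theorem mul_abs_le_abs_sub_of_approximatesLinearOn {E : Type*} [NormedAddCommGroup E]
    [NormedSpace ℝ E] {g : E → ℝ} {L : E →L[ℝ] ℝ} {s : Set E} {c : ℝ≥0}
    (hg : ApproximatesLinearOn g L s c) {z z' e : E} (hz : z ∈ s) (hz' : z' ∈ s) {a : ℝ}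
    (ha : z - z' = a • e) : (|L e| - c * ‖e‖) * |a| ≤ |g z - g z'| := by
  have happrox : |g z - g z' - a * L e| ≤ c * (|a| * ‖e‖) := by
    simpa [ha, norm_smul] using hg z hz z' hz'
  have htriangle := abs_sub (g z - g z') (g z - g z' - a * L e)
  rw [sub_sub_cancel, abs_mul] at htriangle
  linarith

theorem apply_mem_Ico_of_mem_collar {X : Type*} [PseudoMetricSpace X] {Ω s : Set X} {g : X → ℝ}
    {M : ℝ≥0} (hg : LipschitzOnWith M g s) (hΩ : Ω ∩ s = {y ∈ s | g y < 0}) {ε : ℝ} {z : X}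
    (hz : z ∈ collar ε Ω) (hs : Metric.ball z ε ⊆ s) : g z ∈ Ico (-(M * ε)) 0 := by
  obtain ⟨hzΩ, hzthick⟩ := hz
  obtain ⟨w, hwΩ, hzw⟩ := Metric.mem_thickening_iff.1 hzthick
  have hzs : z ∈ s := hs (Metric.mem_ball_self (dist_nonneg.trans_lt hzw))
  have hws : w ∈ s := hs (Metric.mem_ball'.2 hzw)
  have hgw : 0 ≤ g w := not_lt.1 fun hlt =>
    hwΩ ((hΩ.symm ▸ ⟨hws, hlt⟩ : w ∈ Ω ∩ s).1)
  have hlip : |g z - g w| ≤ M * ε :=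
    (hg.dist_le_mul z hzs w hws).trans (by gcongr)
  exact ⟨by linarith [(abs_le.1 hlip).1], (hΩ ▸ ⟨hzΩ, hzs⟩ : z ∈ {y ∈ s | g y < 0}).2⟩

end Sublevel

theorem IsBoundedC1Domain.exists_ball_approximatesLinearOn {Ω : Set (ℝ × ℝ)}
    (hΩ : IsBoundedC1Domain Ω) {x : ℝ × ℝ} (hx : x ∈ frontier Ω) :
    ∃ η > 0, ∃ g : ℝ × ℝ → ℝ, ∃ L : ℝ × ℝ →L[ℝ] ℝ, ∃ c : ℝ≥0, ∃ e : ℝ × ℝ,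
      (e = (1, 0) ∨ e = (0, 1)) ∧ c * ‖e‖ < |L e| ∧
      ApproximatesLinearOn g L (Metric.ball x η) c ∧
      Ω ∩ Metric.ball x η = {y ∈ Metric.ball x η | g y < 0} := by
  obtain ⟨U, g, hU, hxU, hg, hg', hΩU⟩ := hΩ.boundary x hx
  obtain ⟨e, he, hLe⟩ := exists_axis_apply_ne_zero (hg' x hxU)
  have hnorm : ‖e‖ = 1 := by rcases he with rfl | rfl <;> simp [Prod.norm_def]
  have hc : 0 < ‖fderiv ℝ g x e‖₊ / 2 := half_pos (nnnorm_pos.2 hLe)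
  obtain ⟨s, hs, happrox⟩ := ((hg.contDiffAt (hU.mem_nhds hxU)).hasStrictFDerivAt
    one_ne_zero).approximates_deriv_on_nhds (Or.inr hc)
  obtain ⟨η, hη, hball⟩ := Metric.mem_nhds_iff.1 (inter_mem hs (hU.mem_nhds hxU))
  refine ⟨η, hη, g, fderiv ℝ g x, _, e, he, ?_,
    happrox.mono_set (hball.trans inter_subset_left), ?_⟩
  · rw [hnorm, mul_one, NNReal.coe_div, coe_nnnorm, Real.norm_eq_abs]
    exact half_lt_self (abs_pos.2 hLe)
  · ext y
    have hy := Set.ext_iff.1 hΩU y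
    have hyU : y ∈ Metric.ball x η → y ∈ U := fun h => (hball h).2
    simp only [mem_inter_iff, mem_ofPred_eq] at hy ⊢
    tauto

theorem isOpen_collar {X : Type*} [PseudoEMetricSpace X] {Ω : Set X} (hΩ : IsOpen Ω) (ε : ℝ) :
    IsOpen (collar ε Ω) :=
  hΩ.inter Metric.isOpen_thickening

theorem IsBoundedC1Domain.exists_local_collar_bound {Ω : Set (ℝ × ℝ)} (hΩ : IsBoundedC1Domain Ω)
    {x : ℝ × ℝ} (hx : x ∈ frontier Ω) :
    ∃ V ∈ 𝓝 x, ∃ K : ℝ≥0, ∀ᶠ ε in 𝓝[>] (0 : ℝ),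
      volume (V ∩ collar ε Ω) ≤ K * ENNReal.ofReal ε := by
  obtain ⟨η, hη, g, L, c, e, he, hLe, hg, hΩg⟩ := hΩ.exists_ball_approximatesLinearOn hx
  have hlip : LipschitzOnWith (‖L‖₊ + c) g (Metric.ball x η) :=
    lipschitzOnWith_iff_restrict.2 hg.lipschitz
  set M : ℝ≥0 := ‖L‖₊ + c
  set κ : ℝ := |L e| - c * ‖e‖
  have hκ : 0 < κ := sub_pos.2 hLe
  refine ⟨Metric.ball x (η / 2), Metric.ball_mem_nhds x (half_pos hη), (M / κ * η).toNNReal, ?_⟩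
  filter_upwards [Ioo_mem_nhdsGT (half_pos hη)] with ε ⟨hε, hεη⟩
  have hlevel : ∀ z ∈ Metric.ball x (η / 2) ∩ collar ε Ω,
      z ∈ Metric.ball x η ∧ g z ∈ Ico (-(M * ε)) 0 := fun z ⟨hzx, hz⟩ =>
    ⟨Metric.ball_subset_ball (half_le_self hη.le) hzx, apply_mem_Ico_of_mem_collar hlip hΩg hz
      (Metric.ball_subset_ball' (by linarith [Metric.mem_ball.1 hzx]))⟩
  have hslice : ∀ z ∈ Metric.ball x (η / 2) ∩ collar ε Ω,
      ∀ z' ∈ Metric.ball x (η / 2) ∩ collar ε Ω, ∀ a : ℝ, z - z' = a • e →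
      ENNReal.ofReal |a| ≤ ENNReal.ofReal (M / κ * ε) := by
    intro z hz z' hz' a ha
    obtain ⟨hzη, hgz⟩ := hlevel z hz
    obtain ⟨hzη', hgz'⟩ := hlevel z' hz'
    refine ENNReal.ofReal_le_ofReal ?_
    rw [div_mul_eq_mul_div, le_div_iff₀' hκ]
    refine (mul_abs_le_abs_sub_of_approximatesLinearOn hg hzη hzη' ha).trans (abs_le.2 ⟨?_, ?_⟩)
    · linarith [hgz.1, hgz'.2]
    · linarith [hgz.2, hgz'.1]
  calc volume (Metric.ball x (η / 2) ∩ collar ε Ω)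
      ≤ ENNReal.ofReal (M / κ * ε) * ENNReal.ofReal (2 * (η / 2)) :=
        volume_le_of_axis_slices
          (Metric.isOpen_ball.inter (isOpen_collar hΩ.isOpen ε)).measurableSet
          inter_subset_left he hslice
    _ = ENNReal.ofReal (M / κ * η) * ENNReal.ofReal ε := by
        rw [← ENNReal.ofReal_mul (by positivity), ← ENNReal.ofReal_mul (by positivity)]
        ring_nf

theorem collar_subset_thickening_frontier {E : Type*} [NormedAddCommGroup E] [NormedSpace ℝ E]
    [FiniteDimensional ℝ E] (ε : ℝ) (Ω : Set E) :
    collar ε Ω ⊆ Metric.thickening ε (frontier Ω) := by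
  rintro z ⟨hzΩ, hzthick⟩
  obtain ⟨w, hw, hzw⟩ := Metric.mem_thickening_iff.1 hzthick
  obtain ⟨y, hy, hyz⟩ := exists_mem_frontier_infDist_compl_eq_dist hzΩ
    (fun h => hw (h ▸ mem_univ w))
  exact Metric.mem_thickening_iff.2 ⟨y, hy, hyz ▸ (Metric.infDist_le_dist_of_mem hw).trans_lt hzw⟩

theorem IsBoundedC1Domain.isCompact_frontier {Ω : Set (ℝ × ℝ)} (hΩ : IsBoundedC1Domain Ω) :
    IsCompact (frontier Ω) :=
  Metric.isCompact_of_isClosed_isBounded isClosed_frontier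
    (hΩ.isBounded.closure.subset frontier_subset_closure)

theorem IsBoundedC1Domain.exists_nhdsSet_collar_bound {Ω : Set (ℝ × ℝ)}
    (hΩ : IsBoundedC1Domain Ω) :
    ∃ V ∈ 𝓝ˢ (frontier Ω), ∃ K : ℝ≥0, ∀ᶠ ε in 𝓝[>] (0 : ℝ),
      volume (V ∩ collar ε Ω) ≤ K * ENNReal.ofReal ε := by
  refine hΩ.isCompact_frontier.induction_on (p := fun s => ∃ V ∈ 𝓝ˢ s, ∃ K : ℝ≥0,
    ∀ᶠ ε in 𝓝[>] (0 : ℝ), volume (V ∩ collar ε Ω) ≤ K * ENNReal.ofReal ε)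
    ⟨∅, by simp, 0, by simp⟩ ?_ ?_ ?_
  · rintro s t hst ⟨V, hV, hK⟩
    exact ⟨V, nhdsSet_mono hst hV, hK⟩
  · rintro s t ⟨V, hV, K, hK⟩ ⟨V', hV', K', hK'⟩
    refine ⟨V ∪ V', union_mem_nhdsSet hV hV', K + K', ?_⟩
    filter_upwards [hK, hK'] with ε h h'
    rw [union_inter_distrib_right, ENNReal.coe_add, add_mul]
    exact (measure_union_le _ _).trans (add_le_add h h')
  · intro x hx
    obtain ⟨V, hV, hK⟩ := hΩ.exists_local_collar_bound hx
    obtain ⟨W, hWV, hW, hxW⟩ := mem_nhds_iff.1 hV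
    exact ⟨W, mem_nhdsWithin_of_mem_nhds (hW.mem_nhds hxW), V,
      mem_of_superset (hW.mem_nhdsSet_self) hWV, hK⟩

theorem IsBoundedC1Domain.eventually_collar_bound {Ω : Set (ℝ × ℝ)} (hΩ : IsBoundedC1Domain Ω) :
    ∃ K : ℝ≥0, ∀ᶠ ε in 𝓝[>] (0 : ℝ), volume (collar ε Ω) ≤ K * ENNReal.ofReal ε := by
  obtain ⟨V, hV, K, hK⟩ := hΩ.exists_nhdsSet_collar_bound
  obtain ⟨δ, hδ, hδV⟩ := (Metric.hasBasis_nhdsSet_thickening hΩ.isCompact_frontier).mem_iff.1 hV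
  refine ⟨K, ?_⟩
  filter_upwards [hK, Ioo_mem_nhdsGT hδ] with ε hε hεδ
  have hsub : collar ε Ω ⊆ V := (collar_subset_thickening_frontier ε Ω).trans
    ((Metric.thickening_mono hεδ.2.le _).trans hδV)
  rwa [inter_eq_self_of_subset_right hsub] at hε

theorem IsBoundedC1Domain.exists_collar_bound {Ω : Set (ℝ × ℝ)} (hΩ : IsBoundedC1Domain Ω) :
    ∃ K : ℝ≥0, ∀ ε > 0, volume (collar ε Ω) ≤ K * ENNReal.ofReal ε := by
  obtain ⟨K, hK⟩ := hΩ.eventually_collar_bound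
  obtain ⟨ε₀, hε₀, hsmall⟩ := mem_nhdsGT_iff_exists_Ioo_subset.1 hK
  replace hε₀ : 0 < ε₀ := hε₀
  refine ⟨K + (volume.real Ω / ε₀).toNNReal, fun ε hε => ?_⟩
  rw [ENNReal.coe_add, add_mul]
  rcases lt_or_ge ε ε₀ with hlt | hge
  · exact (hsmall ⟨hε, hlt⟩).trans le_self_add
  · refine ((measure_mono inter_subset_left).trans ?_).trans le_add_self
    change volume Ω ≤ ENNReal.ofReal _ * _
    rw [← ofReal_measureReal hΩ.isBounded.measure_lt_top.ne,
      ← ENNReal.ofReal_mul (by positivity), div_mul_eq_mul_div]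
    exact ENNReal.ofReal_le_ofReal
      ((le_div_iff₀ hε₀).2 (mul_le_mul_of_nonneg_left hge measureReal_nonneg))

theorem thickening_smul {E : Type*} [NormedAddCommGroup E] [NormedSpace ℝ E] {r : ℝ} (hr : 0 < r)
    (R : ℝ) (s : Set E) : Metric.thickening R (r • s) = r • Metric.thickening (R / r) s := by
  ext z
  obtain ⟨y, rfl⟩ : ∃ y, r • y = z := ⟨r⁻¹ • z, smul_inv_smul₀ hr.ne' z⟩
  rw [smul_mem_smul_set_iff₀ hr.ne', Metric.mem_thickening_iff_infEDist_lt,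
    Metric.mem_thickening_iff_infEDist_lt, infEDist_smul₀ hr.ne', ENNReal.smul_def, smul_eq_mul,
    ← enorm_eq_nnnorm, Real.enorm_of_nonneg hr.le, ENNReal.ofReal_div_of_pos hr,
    ENNReal.lt_div_iff_mul_lt (by simp [hr]) (by simp), mul_comm]

theorem collar_smul {E : Type*} [NormedAddCommGroup E] [NormedSpace ℝ E] {r : ℝ} (hr : 0 < r)
    (R : ℝ) (Ω : Set E) : collar R (r • Ω) = r • collar (R / r) Ω := by
  have hcompl : (r • Ω)ᶜ = r • Ωᶜ := (smul_set_compl (a := Units.mk0 r hr.ne')).symm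
  rw [collar, hcompl, thickening_smul hr, collar, smul_set_inter₀ hr.ne']

theorem volume_collar_dilate {r : ℝ} (hr : 0 < r) (R : ℝ) (Ω : Set (ℝ × ℝ)) :
    volume (collar R (dilate r Ω)) = ENNReal.ofReal (r ^ 2) * volume (collar (R / r) Ω) := by
  change volume (collar R (r • Ω)) = _
  rw [collar_smul hr, Measure.addHaar_smul, Module.finrank_prod, Module.finrank_self,
    abs_of_nonneg (by positivity)]

end Gabor

end

theorem mainTheorem2_general (φ : Gabor.L2) (hφ : ‖φ‖ = 1) {Ω : Set (ℝ × ℝ)}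
    (hΩ : MeasurableSet Ω) {K : NNReal}
    (hK : ∀ ε : ℝ, 0 < ε → volume (Gabor.collar ε Ω) ≤ K * ENNReal.ofReal ε)
    {lam mu : ℝ} (hlam : 0 < lam) (hmu : mu < 1) :
    ∃ C : ℝ, 0 < C ∧ ∀ r : ℝ, 0 < r →
      Gabor.eigenvalueCount (Gabor.concentrationOp φ (Gabor.dilate r Ω)) lam mu
        ≤ ENNReal.ofReal (C * r) := by
  obtain ⟨R, hR, hcount⟩ := Gabor.exists_eigenvalueCount_concentrationOp_le hφ hlam hmu
  refine ⟨K * R / (lam / 2) + 1, by positivity, fun r hr => ?_⟩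
  have hdilate : MeasurableSet (Gabor.dilate r Ω) := hΩ.const_smul₀ r
  calc Gabor.eigenvalueCount (Gabor.concentrationOp φ (Gabor.dilate r Ω)) lam mu
      ≤ volume (Gabor.collar R (Gabor.dilate r Ω)) / ENNReal.ofReal (lam / 2) := hcount _ hdilate
    _ = ENNReal.ofReal (r ^ 2) * volume (Gabor.collar (R / r) Ω) / ENNReal.ofReal (lam / 2) := by
        rw [Gabor.volume_collar_dilate hr]
    _ ≤ ENNReal.ofReal (r ^ 2) * (K * ENNReal.ofReal (R / r)) / ENNReal.ofReal (lam / 2) := by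
        gcongr
        exact hK _ (by positivity)
    _ = ENNReal.ofReal (K * R / (lam / 2) * r) := by
        rw [← ENNReal.ofReal_coe_nnreal, ← ENNReal.ofReal_mul (by positivity),
          ← ENNReal.ofReal_mul (by positivity), ← ENNReal.ofReal_div_of_pos (by positivity)]
        congr 1
        field_simp
    _ ≤ ENNReal.ofReal ((K * R / (lam / 2) + 1) * r) := by
        gcongr
        linarith

theorem mainTheorem2 (φ : Gabor.L2) (hφ : ‖φ‖ = 1) (Ω : Set (ℝ × ℝ))
    (hΩ : Gabor.IsBoundedC1Domain Ω)
    (hdecay : Gabor.TailDecay (fun z => ‖Gabor.gabor φ φ z‖ ^ 2))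
    (lam mu : ℝ) (hlam : 0 < lam) (hlm : lam < mu) (hmu : mu < 1) :
    ∃ C : ℝ, 0 < C ∧ ∀ r : ℝ, 0 < r →
      Gabor.eigenvalueCount (Gabor.concentrationOp φ (Gabor.dilate r Ω)) lam mu
        ≤ ENNReal.ofReal (C * r) := by
  obtain ⟨K, hK⟩ := hΩ.exists_collar_bound
  exact mainTheorem2_general φ hφ hΩ.isOpen.measurableSet hK hlam hmu
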